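/- Let $\hbar>0$ and let $\psi\in L^2(\mathbb R)$ with $\|\psi\|=1$. Let $(X\varphi)(x)=x\varphi(x)$ and $(P\varphi)(x)=-i\hbar\varphi'(x)$ for Schwartz functions $\varphi$ on $\mathbb R$. For real $\alpha,\beta$ there is exactly one strongly continuous one-parameter unitary group $U_{\alpha,\beta}$ on $L^2(\mathbb R)$ such that $\frac{d}{dt}\big|_{t=0}U_{\alpha,\beta}(t)\varphi=i(\alpha X+\beta P)\varphi$ (derivative in $L^2$) for every Schwartz function $\varphi$; write $e^{i(\alpha X+\beta P)}=U_{\alpha,\beta}(1)$. For a Schwartz function $g:\mathbb R^2\to\mathbb C$ put $$\hat g(\alpha,\beta)=\frac1{2\pi}\iint g(x,p)e^{-i(\alpha x+\beta p)}\,dx\,dp,\qquad g(X,P)=\frac1{2\pi}\iint \hat g(\alpha,\beta)\,e^{i(\alpha X+\beta P)}\,d\alpha\,d\beta,$$ where the operator integral, applied to any vector of $L^2(\mathbb R)$, converges absolutely in $L^2(\mathbb R)$. Call a function $f:\mathbb R^2\to\mathbb C$ Weyl-compatible (for $\psi$) if for every Schwartz function $g$ on $\mathbb R^2$ the integral $\iint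 g f\,dx\,dp$ converges absolutely and $$\iint g(x,p)f(x,p)\,dx\,dp=\langle\psi|g(X,P)|\psi\rangle .$$ Then the Wigner function $$W_\psi(x,p)=\frac1{2\pi}\int \overline{\psi\!\left(x+\tfrac{\beta\hbar}2\right)}\,\psi\!\left(x-\tfrac{\beta\hbar}2\right)e^{i\beta p}\,d\beta$$ (the integral converges absolutely at every $(x,p)$, and its value is real) is Weyl-compatible, and every Weyl-compatible function $f$ is equal to $W_\psi$ almost everywhere. -/

import Mathlib

open MeasureTheory Complex
open scoped SchwartzMap

noncomputable section

namespace WeylWigner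

/-- The Hilbert space `L²(ℝ)` of a particle moving in one dimension. -/
abbrev L2 : Type := Lp ℂ 2 (volume : Measure ℝ)

/-- The position operator `X` on nice (Schwartz) functions, `(Xφ)(x) = x φ(x)`;
see `positionOp_apply`. -/
def positionOp : 𝓢(ℝ, ℂ) →ₗ[ℂ] 𝓢(ℝ, ℂ) :=
  (SchwartzMap.smulLeftCLM ℂ (fun x : ℝ => (x : ℂ))).toLinearMap

/-- The momentum operator `P` on nice (Schwartz) functions, `(Pφ)(x) = -iħ φ'(x)`;
see `momentumOp_apply`. -/
def momentumOp (ℏ : ℝ) : 𝓢(ℝ, ℂ) →ₗ[ℂ] 𝓢(ℝ, ℂ) :=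
  (-I * (ℏ : ℂ)) • (SchwartzMap.derivCLM ℂ ℂ).toLinearMap

theorem positionOp_apply (φ : 𝓢(ℝ, ℂ)) (x : ℝ) : positionOp φ x = (x : ℂ) * φ x := by
  have h : Function.HasTemperateGrowth (fun x : ℝ => (x : ℂ)) :=
    Complex.ofRealCLM.hasTemperateGrowth
  simp [positionOp, SchwartzMap.smulLeftCLM_apply_apply h]

theorem momentumOp_apply (ℏ : ℝ) (φ : 𝓢(ℝ, ℂ)) (x : ℝ) :
    momentumOp ℏ φ x = -I * (ℏ : ℂ) * deriv φ x := by
  simp [momentumOp]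

/-- `U` is a strongly continuous one-parameter unitary group on `L²(ℝ)` whose infinitesimal
generator extends `iA`, where `A` is an operator defined on the Schwartz functions. When `A` is
essentially self-adjoint there is exactly one such `U`, namely `U t = e^{itA}`. -/
structure IsUnitaryGroupGeneratedBy (A : 𝓢(ℝ, ℂ) →ₗ[ℂ] 𝓢(ℝ, ℂ))
    (U : ℝ → L2 →L[ℂ] L2) : Prop where
  unitary : ∀ t, U t ∈ unitary (L2 →L[ℂ] L2)
  map_zero : U 0 = 1
  map_add : ∀ s t, U (s + t) = U s * U t
  continuous : ∀ φ : L2, Continuous fun t => U t φ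
  generator : ∀ φ : 𝓢(ℝ, ℂ),
    HasDerivAt (fun t => U t (φ.toLp 2 volume)) (I • (A φ).toLp 2 volume) 0

open Classical in
/-- The unitary operator `e^{iA}` on `L²(ℝ)`: the value at time `1` of the unitary group
generated by `A`. -/
def expI (A : 𝓢(ℝ, ℂ) →ₗ[ℂ] 𝓢(ℝ, ℂ)) : L2 →L[ℂ] L2 :=
  if h : ∃ U : ℝ → L2 →L[ℂ] L2, IsUnitaryGroupGeneratedBy A U then h.choose 1 else 0

/-- The linear combination `αX + βP` of position and momentum. -/
def linComb (ℏ α β : ℝ) : 𝓢(ℝ, ℂ) →ₗ[ℂ] 𝓢(ℝ, ℂ) :=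
  (α : ℂ) • positionOp + (β : ℂ) • momentumOp ℏ

/-- The forward Fourier transform on the phase plane, in the unitary normalization
`ĝ(α,β) = (1/2π) ∬ g(x,p) e^{-i(αx+βp)} dx dp`. -/
def fourierPhase (g : ℝ × ℝ → ℂ) (α β : ℝ) : ℂ :=
  (1 / (2 * Real.pi) : ℂ) *
    ∫ z : ℝ × ℝ, g z * Complex.exp (-I * ((α * z.1 + β * z.2 : ℝ) : ℂ))

/-- The integrand `ĝ(α,β) e^{i(αX+βP)} φ` of the Weyl correspondence, at `w = (α,β)`. -/
def weylIntegrand (ℏ : ℝ) (g : 𝓢(ℝ × ℝ, ℂ)) (φ : L2) (w : ℝ × ℝ) : L2 :=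
  fourierPhase g w.1 w.2 • expI (linComb ℏ w.1 w.2) φ

/-- The Weyl quantization
`g(X,P) = (1/2π) ∬ ĝ(α,β) e^{i(αX+βP)} dα dβ`, the operator-valued integral being taken in the
strong sense (as an `L²`-valued Bochner integral after application to a vector `φ`). -/
def weylQuantization (ℏ : ℝ) (g : 𝓢(ℝ × ℝ, ℂ)) (φ : L2) : L2 :=
  (1 / (2 * Real.pi) : ℂ) • ∫ w : ℝ × ℝ, weylIntegrand ℏ g φ w

/-- `f` is Weyl-compatible for the state `ψ`: for every Schwartz function `g` on the phase plane,
`∬ g f` converges absolutely and equals the expectation `⟨ψ|g(X,P)|ψ⟩`. -/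
def IsWeylCompatible (ℏ : ℝ) (ψ : L2) (f : ℝ × ℝ → ℂ) : Prop :=
  ∀ g : 𝓢(ℝ × ℝ, ℂ),
    Integrable (fun z : ℝ × ℝ => g z * f z) ∧
      ∫ z : ℝ × ℝ, g z * f z = inner ℂ ψ (weylQuantization ℏ g ψ)

/-- The integrand `ψ*(x + βħ/2) ψ(x - βħ/2) e^{iβp}` of Wigner's function. -/
def wignerIntegrand (ℏ : ℝ) (ψ : L2) (z : ℝ × ℝ) (β : ℝ) : ℂ :=
  (starRingEnd ℂ) (ψ (z.1 + β * ℏ / 2)) * ψ (z.1 - β * ℏ / 2) *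
    Complex.exp (I * ((β * z.2 : ℝ) : ℂ))

/-- Wigner's function
`W(x,p) = (1/2π) ∫ ψ*(x + βħ/2) ψ(x - βħ/2) e^{iβp} dβ`, at `z = (x,p)`. -/
def wigner (ℏ : ℝ) (ψ : L2) (z : ℝ × ℝ) : ℂ :=
  (1 / (2 * Real.pi) : ℂ) * ∫ β : ℝ, wignerIntegrand ℏ ψ z β

end WeylWigner

end

noncomputable section

namespace WeylWigner

open Filter Topology
open scoped FourierTransform ComplexConjugate

/-! The group generated by `αX + βP` is explicit: a translation by `tβħ` times a plane wave
(`weylGroup`). It preserves the Schwartz space, so for any other group `U` with the same generator,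
`U(-t)V(t)φ` has derivative zero for every Schwartz `φ`, whence `U = V` by density
(`eq_of_invariant`). This identifies `e^{i(αX+βP)}` with `weylOp α (βħ)`.

Centring the translation in `⟨ψ|e^{i(αX+βP)}ψ⟩` turns it into a Fourier integral in position of
`ψ*(y - βħ/2) ψ(y + βħ/2)` (`inner_weylOp`). Inserted in the Weyl integral, Fourier inversion in `α`
undoes the position half of `ĝ` and leaves a double integral of this kernel against the momentum
transform of `g` (`inner_weylQuantization`). Fubini brings `∬ g W` to the same form
(`integral_mul_wigner`).

Uniqueness is the fundamental lemma of the calculus of variations: smooth compactly supported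
functions are admissible `g`. -/

/-- The function `x ↦ e^{i(ax + c)}`. -/
def planeWave (a c x : ℝ) : ℂ := Complex.exp (I * ((a * x + c : ℝ) : ℂ))

@[simp]
theorem norm_planeWave (a c x : ℝ) : ‖planeWave a c x‖ = 1 := by
  rw [planeWave, mul_comm, Complex.norm_exp_ofReal_mul_I]

theorem continuous_planeWave (a c : ℝ) : Continuous (planeWave a c) := by
  unfold planeWave
  fun_prop

theorem hasDerivAt_planeWave (a c x : ℝ) :
    HasDerivAt (planeWave a c) (I * a * planeWave a c x) x := by
  have h : HasDerivAt (fun x : ℝ => I * ((a * x + c : ℝ) : ℂ)) (I * a) x := by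
    have := (((hasDerivAt_id x).const_mul a).add_const c).ofReal_comp.const_mul I
    simpa using this
  rw [mul_comm]
  exact h.cexp

theorem iteratedDeriv_planeWave (a c : ℝ) (n : ℕ) :
    iteratedDeriv n (planeWave a c) = fun x => (I * a) ^ n * planeWave a c x := by
  induction n with
  | zero => simp
  | succ n ih =>
    ext x
    rw [iteratedDeriv_succ, ih, ((hasDerivAt_planeWave a c x).const_mul _).deriv]
    ring

theorem hasTemperateGrowth_planeWave (a c : ℝ) :
    Function.HasTemperateGrowth (planeWave a c) := by
  refine ⟨?_, fun n => ⟨0, |a| ^ n, fun x => ?_⟩⟩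
  · unfold planeWave
    have : ContDiff ℝ (⊤ : ℕ∞) (fun x : ℝ => ((a * x + c : ℝ) : ℂ)) :=
      Complex.ofRealCLM.contDiff.comp ((contDiff_const.mul contDiff_id).add contDiff_const)
    exact (contDiff_const.mul this).cexp
  · rw [norm_iteratedFDeriv_eq_norm_iteratedDeriv, iteratedDeriv_planeWave]
    simp

/-! ### Explicit Weyl operators -/

theorem memLp_weyl (a b : ℝ) (φ : L2) :
    MemLp (fun x => planeWave a (a * b / 2) x * φ (x + b)) 2 volume := by
  have h : MemLp (fun x => φ (x + b)) 2 volume :=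
    (Lp.memLp φ).comp_measurePreserving (measurePreserving_add_right volume b)
  refine h.of_le
    ((continuous_planeWave a _).aestronglyMeasurable.mul h.aestronglyMeasurable) ?_
  filter_upwards with x
  simp

theorem ae_comp_add_right {p : ℝ → Prop} (h : ∀ᵐ x, p x) (b : ℝ) : ∀ᵐ x, p (x + b) :=
  (measurePreserving_add_right volume b).quasiMeasurePreserving.ae h

/-- The unitary operator `(V(a,b)φ)(x) = e^{i(ax + ab/2)} φ(x + b)`, as a linear isometry. -/
def weylOp (a b : ℝ) : L2 →ₗᵢ[ℂ] L2 where
  toFun φ := (memLp_weyl a b φ).toLp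
  map_add' φ χ := by
    rw [← MemLp.toLp_add, MemLp.toLp_eq_toLp_iff]
    filter_upwards [ae_comp_add_right (Lp.coeFn_add φ χ) b] with x hx
    simp only [Pi.add_apply] at hx ⊢
    rw [hx, mul_add]
  map_smul' c φ := by
    rw [RingHom.id_apply, ← MemLp.toLp_const_smul, MemLp.toLp_eq_toLp_iff]
    filter_upwards [ae_comp_add_right (Lp.coeFn_smul c φ) b] with x hx
    simp [hx, mul_left_comm]
  norm_map' φ := by
    change ‖(memLp_weyl a b φ).toLp‖ = ‖φ‖
    rw [Lp.norm_toLp, Lp.norm_def]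
    congr 1
    rw [← eLpNorm_comp_measurePreserving (Lp.aestronglyMeasurable φ)
      (measurePreserving_add_right volume b)]
    exact eLpNorm_congr_norm_ae (by filter_upwards with x; simp)

theorem weylOp_ae (a b : ℝ) (φ : L2) :
    weylOp a b φ =ᵐ[volume] fun x => planeWave a (a * b / 2) x * φ (x + b) :=
  (memLp_weyl a b φ).coeFn_toLp

theorem weylOp_zero (φ : L2) : weylOp 0 0 φ = φ := by
  refine Lp.ext ?_
  filter_upwards [weylOp_ae 0 0 φ] with x hx
  simp [hx, planeWave]

/-- The constant phase `ab/2` makes this exact: translation contributes the cross term `st·ab`,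
completing `(s² + t²)ab/2` to `(s + t)²ab/2`. -/
theorem weylOp_weylOp (a b s t : ℝ) (φ : L2) :
    weylOp (s * a) (s * b) (weylOp (t * a) (t * b) φ) =
      weylOp ((s + t) * a) ((s + t) * b) φ := by
  refine Lp.ext ?_
  filter_upwards [weylOp_ae (s * a) (s * b) (weylOp (t * a) (t * b) φ),
    weylOp_ae ((s + t) * a) ((s + t) * b) φ,
    ae_comp_add_right (weylOp_ae (t * a) (t * b) φ) (s * b)] with x h1 h2 h3
  rw [h1, h2, h3, ← mul_assoc, planeWave, planeWave, planeWave, ← Complex.exp_add]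
  congr 2
  · push_cast; ring
  · ring_nf

/-- The action of the Weyl operators on Schwartz functions. -/
def weylSchwartz (a b : ℝ) (φ : 𝓢(ℝ, ℂ)) : 𝓢(ℝ, ℂ) :=
  SchwartzMap.smulLeftCLM ℂ (planeWave a (a * b / 2)) (SchwartzMap.compSubConstCLM ℂ (-b) φ)

theorem weylSchwartz_apply (a b : ℝ) (φ : 𝓢(ℝ, ℂ)) (x : ℝ) :
    weylSchwartz a b φ x = planeWave a (a * b / 2) x * φ (x + b) := by
  rw [weylSchwartz, SchwartzMap.smulLeftCLM_apply_apply (hasTemperateGrowth_planeWave _ _),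
    SchwartzMap.compSubConstCLM_apply, sub_neg_eq_add, smul_eq_mul]

theorem weylOp_toLp (a b : ℝ) (φ : 𝓢(ℝ, ℂ)) :
    weylOp a b (φ.toLp 2 volume) = (weylSchwartz a b φ).toLp 2 volume := by
  refine Lp.ext ?_
  filter_upwards [weylOp_ae a b (φ.toLp 2 volume), (weylSchwartz a b φ).coeFn_toLp 2 volume,
    ae_comp_add_right (φ.coeFn_toLp 2 volume) b] with x h1 h2 h3
  rw [h1, h2, h3, weylSchwartz_apply]

/-! ### Dominated convergence in `L²` -/

/-- Scalar dominated convergence applied to `‖F n‖² = ∫ ‖G n x‖²`. It serves both strong continuity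
and the generator. -/
theorem tendsto_zero_L2_of_dominated {ι : Type*} {l : Filter ι} [l.IsCountablyGenerated]
    {F : ι → L2} {G : ι → ℝ → ℂ} {bound : ℝ → ℝ} (hFG : ∀ n, F n =ᵐ[volume] G n)
    (hbound : Integrable fun x => bound x ^ 2)
    (hG : ∀ᶠ n in l, ∀ x, ‖G n x‖ ≤ bound x)
    (hlim : ∀ x, Tendsto (fun n => G n x) l (𝓝 0)) : Tendsto F l (𝓝 0) := by
  have hnorm (n : ι) : ‖F n‖ ^ 2 = ∫ x, ‖G n x‖ ^ 2 := by
    rw [← inner_self_eq_norm_sq (𝕜 := ℂ), L2.inner_def, ← integral_re (L2.integrable_inner _ _)]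
    refine integral_congr_ae ?_
    filter_upwards [hFG n] with x hx
    rw [inner_self_eq_norm_sq, hx]
  have hsq : Tendsto (fun n => ‖F n‖ ^ 2) l (𝓝 0) := by
    simp_rw [hnorm]
    have := tendsto_integral_filter_of_dominated_convergence (l := l)
      (F := fun n x => ‖G n x‖ ^ 2) (f := fun _ : ℝ => (0 : ℝ)) (μ := volume) (fun x => bound x ^ 2)
      (Eventually.of_forall fun n =>
        (((Lp.aestronglyMeasurable (F n)).congr (hFG n)).norm.pow 2)) ?_ hbound ?_
    · simpa using this
    · filter_upwards [hG] with n hn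
      filter_upwards with x
      rw [Real.norm_of_nonneg (by positivity)]
      exact pow_le_pow_left₀ (norm_nonneg _) (hn x) 2
    · filter_upwards with x
      simpa using ((hlim x).norm.pow 2)
  rw [tendsto_zero_iff_norm_tendsto_zero]
  have := hsq.sqrt
  simpa [Real.sqrt_sq (norm_nonneg _)] using this

theorem exists_shift_bound (φ : 𝓢(ℝ, ℂ)) (R : ℝ) :
    ∃ C : ℝ, ∀ b x : ℝ, |b| ≤ R → ‖φ (x + b)‖ ≤ C * (1 + x ^ 2)⁻¹ := by
  obtain ⟨C₀, h₀, hC₀⟩ := φ.decay 0 0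
  obtain ⟨C₂, h₂, hC₂⟩ := φ.decay 2 0
  simp only [norm_iteratedFDeriv_zero, pow_zero, one_mul] at hC₀ hC₂
  refine ⟨C₀ * (1 + 2 * R ^ 2) + 2 * C₂, fun b x hb => ?_⟩
  rw [← div_eq_mul_inv, le_div_iff₀ (by positivity)]
  -- From `x = (x + b) - b`; the slack is at least `(x + 2b)²`.
  have hx : 1 + x ^ 2 ≤ 1 + 2 * R ^ 2 + 2 * ‖x + b‖ ^ 2 := by
    have : b ^ 2 ≤ R ^ 2 := sq_le_sq' (abs_le.1 hb).1 (abs_le.1 hb).2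
    rw [Real.norm_eq_abs, sq_abs]
    nlinarith [sq_nonneg (x + 2 * b)]
  calc ‖φ (x + b)‖ * (1 + x ^ 2)
      ≤ ‖φ (x + b)‖ * (1 + 2 * R ^ 2 + 2 * ‖x + b‖ ^ 2) := by gcongr
    _ = ‖φ (x + b)‖ * (1 + 2 * R ^ 2) + 2 * (‖x + b‖ ^ 2 * ‖φ (x + b)‖) := by ring
    _ ≤ C₀ * (1 + 2 * R ^ 2) + 2 * C₂ := by
        gcongr
        · exact hC₀ _
        · exact hC₂ _

theorem integrable_sq_inv_one_add_sq (C : ℝ) :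
    Integrable fun x : ℝ => (C * (1 + x ^ 2)⁻¹) ^ 2 := by
  simp_rw [mul_pow]
  refine Integrable.const_mul ?_ _
  refine integrable_inv_one_add_sq.mono' (by fun_prop) ?_
  filter_upwards with x
  have h1 : (1 + x ^ 2)⁻¹ ≤ 1 := inv_le_one_of_one_le₀ (by nlinarith [sq_nonneg x])
  have h0 : 0 ≤ (1 + x ^ 2)⁻¹ := by positivity
  rw [Real.norm_of_nonneg (by positivity)]
  nlinarith

/-! ### Strong continuity -/

theorem dense_toLp : DenseRange (fun φ : 𝓢(ℝ, ℂ) => (φ.toLp 2 volume : L2)) :=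
  SchwartzMap.denseRange_toLpCLM (by simp)

theorem continuous_weylOp_toLp (φ : 𝓢(ℝ, ℂ)) :
    Continuous fun w : ℝ × ℝ => weylOp w.1 w.2 (φ.toLp 2 volume) := by
  rw [continuous_iff_continuousAt]
  intro w₀
  rw [ContinuousAt, ← tendsto_sub_nhds_zero_iff]
  obtain ⟨C, hC⟩ := exists_shift_bound φ (|w₀.2| + 1)
  refine tendsto_zero_L2_of_dominated
    (G := fun w x => weylSchwartz w.1 w.2 φ x - weylSchwartz w₀.1 w₀.2 φ x)
    (bound := fun x => 2 * C * (1 + x ^ 2)⁻¹) ?_ (integrable_sq_inv_one_add_sq _) ?_ ?_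
  · intro w
    rw [weylOp_toLp, weylOp_toLp]
    filter_upwards [Lp.coeFn_sub ((weylSchwartz w.1 w.2 φ).toLp 2 volume)
        ((weylSchwartz w₀.1 w₀.2 φ).toLp 2 volume), (weylSchwartz w.1 w.2 φ).coeFn_toLp 2 volume,
      (weylSchwartz w₀.1 w₀.2 φ).coeFn_toLp 2 volume] with x h1 h2 h3
    rw [h1, Pi.sub_apply, h2, h3]
  · have hnear : ∀ᶠ w : ℝ × ℝ in 𝓝 w₀, |w.2| < |w₀.2| + 1 :=
      (continuous_snd.abs.continuousAt (x := w₀)).eventually_lt continuousAt_const (by simp)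
    filter_upwards [hnear] with w hw x
    refine (norm_sub_le _ _).trans ?_
    simp only [weylSchwartz_apply, norm_mul, norm_planeWave, one_mul]
    linarith [hC w.2 x hw.le, hC w₀.2 x (by simp)]
  · intro x
    rw [tendsto_sub_nhds_zero_iff]
    have : Continuous fun w : ℝ × ℝ => weylSchwartz w.1 w.2 φ x := by
      simp only [weylSchwartz_apply, planeWave]
      have := φ.continuous
      fun_prop
    exact this.tendsto w₀

/-- The operators are isometries, so Schwartz approximation of `φ` is uniform in `w`. -/
theorem continuous_weylOp (φ : L2) : Continuous fun w : ℝ × ℝ => weylOp w.1 w.2 φ := by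
  refine continuous_of_uniform_approx_of_continuous fun u hu => ?_
  obtain ⟨ε, hε, hu⟩ := Metric.mem_uniformity_dist.1 hu
  obtain ⟨χ, hχ⟩ := dense_toLp.exists_dist_lt φ hε
  refine ⟨_, continuous_weylOp_toLp χ, fun w => hu ?_⟩
  rwa [(weylOp w.1 w.2).dist_map]

/-! ### The generator -/

theorem linComb_apply (ℏ α β : ℝ) (φ : 𝓢(ℝ, ℂ)) (x : ℝ) :
    I * linComb ℏ α β φ x = I * α * x * φ x + (β * ℏ : ℝ) * deriv φ x := by
  simp only [linComb, LinearMap.add_apply, LinearMap.smul_apply, add_apply,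
    smul_apply, positionOp_apply, momentumOp_apply, smul_eq_mul]
  push_cast
  linear_combination -(β * ℏ * deriv φ x) * I_sq

theorem hasDerivAt_weylSchwartz (ℏ α β : ℝ) (φ : 𝓢(ℝ, ℂ)) (x t : ℝ) :
    HasDerivAt (fun t : ℝ => weylSchwartz (t * α) (t * (β * ℏ)) φ x)
      (planeWave (t * α) (t * α * (t * (β * ℏ)) / 2) x *
        (I * linComb ℏ α β φ (x + t * (β * ℏ)))) t := by
  simp only [weylSchwartz_apply, linComb_apply]
  have h1 : HasDerivAt (fun t : ℝ => planeWave (t * α) (t * α * (t * (β * ℏ)) / 2) x)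
      (planeWave (t * α) (t * α * (t * (β * ℏ)) / 2) x * (I * (α * (x + t * (β * ℏ)) : ℝ))) t := by
    have h0 : HasDerivAt (fun t : ℝ => t * α * x + t * α * (t * (β * ℏ)) / 2)
        (α * (x + t * (β * ℏ))) t := by
      have hid := hasDerivAt_id' t
      refine (((hid.mul_const α).mul_const x).fun_add
        (((hid.mul_const α).fun_mul (hid.mul_const (β * ℏ))).div_const 2)).congr_deriv ?_
      ring
    exact (h0.ofReal_comp.const_mul I).cexp
  have h2 : HasDerivAt (fun t : ℝ => φ (x + t * (β * ℏ)))
      ((β * ℏ : ℝ) * deriv φ (x + t * (β * ℏ))) t := by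
    have h3 : HasDerivAt (fun t : ℝ => x + t * (β * ℏ)) (β * ℏ) t := by
      simpa using ((hasDerivAt_id' t).mul_const (β * ℏ)).const_add x
    have := (φ.differentiableAt (x := x + t * (β * ℏ))).hasDerivAt.scomp t h3
    simpa [Function.comp_def] using this
  refine (h1.fun_mul h2).congr_deriv ?_
  push_cast
  ring

theorem hasDerivAt_weylOp_zero (ℏ α β : ℝ) (φ : 𝓢(ℝ, ℂ)) :
    HasDerivAt (fun t : ℝ => weylOp (t * α) (t * (β * ℏ)) (φ.toLp 2 volume))
      (I • (linComb ℏ α β φ).toLp 2 volume) 0 := by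
  rw [hasDerivAt_iff_tendsto_slope, ← tendsto_sub_nhds_zero_iff]
  set η := linComb ℏ α β φ
  obtain ⟨C, hC⟩ := exists_shift_bound η |β * ℏ|
  refine tendsto_zero_L2_of_dominated
    (G := fun t x => slope (fun t : ℝ => weylSchwartz (t * α) (t * (β * ℏ)) φ x) 0 t - I * η x)
    (bound := fun x => 2 * C * (1 + x ^ 2)⁻¹) ?_ (integrable_sq_inv_one_add_sq _) ?_ ?_
  · intro t
    simp only [slope, vsub_eq_sub, weylOp_toLp, sub_zero]
    set f := weylSchwartz (t * α) (t * (β * ℏ)) φ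
    set g := weylSchwartz (0 * α) (0 * (β * ℏ)) φ
    filter_upwards [Lp.coeFn_sub (t⁻¹ • (f.toLp 2 volume - g.toLp 2 volume))
        (I • η.toLp 2 volume), Lp.coeFn_smul t⁻¹ (f.toLp 2 volume - g.toLp 2 volume),
      Lp.coeFn_sub (f.toLp 2 volume) (g.toLp 2 volume), Lp.coeFn_smul I (η.toLp 2 volume),
      f.coeFn_toLp 2 volume, g.coeFn_toLp 2 volume, η.coeFn_toLp 2 volume]
      with x h1 h2 h3 h4 h5 h6 h7
    simp only [Pi.sub_apply, Pi.smul_apply, smul_eq_mul] at h1 h2 h3 h4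
    rw [h1, h2, h3, h4, h5, h6, h7]
  · have hnear : ∀ᶠ t : ℝ in 𝓝[≠] 0, |t| < 1 := by
      refine nhdsWithin_le_nhds ?_
      exact (continuous_abs.continuousAt (x := (0 : ℝ))).eventually_lt
        (continuousAt_const (y := (1 : ℝ))) (by simp)
    filter_upwards [hnear, self_mem_nhdsWithin] with t ht ht0 x
    have ht0' : t ≠ 0 := ht0
    have hb : ∀ s ∈ Set.Icc (-1 : ℝ) 1, ‖planeWave (s * α) (s * α * (s * (β * ℏ)) / 2) x *
        (I * η (x + s * (β * ℏ)))‖ ≤ C * (1 + x ^ 2)⁻¹ := by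
      intro s hs
      rw [norm_mul, norm_planeWave, one_mul, norm_mul, norm_I, one_mul]
      refine hC _ _ ?_
      rw [abs_mul]
      exact mul_le_of_le_one_left (abs_nonneg _) (abs_le.2 hs)
    -- The mean value inequality dominates the difference quotients; this is why the pointwise
    -- derivative is needed at all times, not only at 0.
    have hmv := Convex.norm_image_sub_le_of_norm_hasDerivWithin_le (𝕜 := ℝ) (x := 0) (y := t)
      (fun s _ => (hasDerivAt_weylSchwartz ℏ α β φ x s).hasDerivWithinAt) hb
      (convex_Icc _ _) (by simp) (abs_le.1 ht.le)
    have h0 : ‖I * η x‖ ≤ C * (1 + x ^ 2)⁻¹ := by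
      simpa using hC 0 x (by simpa using abs_nonneg (β * ℏ))
    have h1 : ‖slope (fun t : ℝ => weylSchwartz (t * α) (t * (β * ℏ)) φ x) 0 t‖ ≤
        C * (1 + x ^ 2)⁻¹ := by
      rw [slope, sub_zero, norm_smul, norm_inv, inv_mul_le_iff₀ (norm_pos_iff.2 ht0'), vsub_eq_sub]
      rw [sub_zero, mul_comm _ ‖t‖] at hmv
      exact hmv
    refine (norm_sub_le _ _).trans ?_
    linarith
  · intro x
    rw [tendsto_sub_nhds_zero_iff]
    have := hasDerivAt_weylSchwartz ℏ α β φ x 0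
    rw [hasDerivAt_iff_tendsto_slope] at this
    simpa [planeWave] using this

/-- The one-parameter group `t ↦ e^{it(αX+βP)}` in closed form. -/
def weylGroup (ℏ α β t : ℝ) : L2 →L[ℂ] L2 :=
  (weylOp (t * α) (t * (β * ℏ))).toContinuousLinearMap

theorem weylGroup_apply (ℏ α β t : ℝ) (φ : L2) :
    weylGroup ℏ α β t φ = weylOp (t * α) (t * (β * ℏ)) φ := rfl

theorem isUnitaryGroupGeneratedBy_weylGroup (ℏ α β : ℝ) :
    IsUnitaryGroupGeneratedBy (linComb ℏ α β) (weylGroup ℏ α β) := by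
  have hzero : weylGroup ℏ α β 0 = 1 := by
    ext1 φ
    simp [weylGroup_apply, weylOp_zero]
  have hadd (s t : ℝ) : weylGroup ℏ α β (s + t) = weylGroup ℏ α β s * weylGroup ℏ α β t := by
    ext1 φ
    exact (weylOp_weylOp _ _ _ _ _).symm
  refine ⟨fun t => ?_, hzero, hadd, fun φ => ?_, hasDerivAt_weylOp_zero ℏ α β⟩
  · have h1 : star (weylGroup ℏ α β t) * weylGroup ℏ α β t = 1 :=
      (ContinuousLinearMap.norm_map_iff_adjoint_comp_self _).1
        (fun φ => (weylOp _ _).norm_map φ)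
    have h2 : weylGroup ℏ α β t * weylGroup ℏ α β (-t) = 1 := by
      rw [← hadd, add_neg_cancel, hzero]
    refine ⟨h1, ?_⟩
    -- The adjoint is a left inverse and the time `-t` operator a right inverse, so they coincide.
    rwa [left_inv_eq_right_inv h1 h2]
  · exact (continuous_weylOp φ).comp (f := fun t : ℝ => (t * α, t * (β * ℏ))) (by fun_prop)

/-! ### Uniqueness -/

namespace IsUnitaryGroupGeneratedBy

variable {A : 𝓢(ℝ, ℂ) →ₗ[ℂ] 𝓢(ℝ, ℂ)} {U V : ℝ → L2 →L[ℂ] L2}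

theorem norm_apply (hU : IsUnitaryGroupGeneratedBy A U) (t : ℝ) (φ : L2) : ‖U t φ‖ = ‖φ‖ :=
  (ContinuousLinearMap.norm_map_iff_adjoint_comp_self (U t)).2 (hU.unitary t).1 φ

theorem neg_apply_apply (hU : IsUnitaryGroupGeneratedBy A U) (t : ℝ) (φ : L2) :
    U t (U (-t) φ) = φ := by
  have := hU.map_add t (-t)
  rw [add_neg_cancel, hU.map_zero] at this
  exact (DFunLike.congr_fun this φ).symm

/-- A product rule under strong differentiability only: split `U(-t)V(t)χ = U(-t)(V(t)χ - χ) +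
U(-t)χ`. The first term is controlled by isometry and strong continuity of `U`, and the two
derivatives cancel. -/
theorem hasDerivAt_neg_comp_zero (hU : IsUnitaryGroupGeneratedBy A U)
    (hV : IsUnitaryGroupGeneratedBy A V) (φ : 𝓢(ℝ, ℂ)) :
    HasDerivAt (fun t => U (-t) (V t (φ.toLp 2 volume))) 0 0 := by
  set χ : L2 := φ.toLp 2 volume
  have hUneg : HasDerivAt (fun t => U (-t) χ) (-(I • (A φ).toLp 2 volume)) 0 := by
    have := hU.generator φ
    rw [← neg_zero] at this
    simpa [Function.comp_def] using this.scomp (0 : ℝ) (hasDerivAt_neg (0 : ℝ))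
  have hrest : HasDerivAt (fun t => U (-t) (V t χ - χ)) (I • (A φ).toLp 2 volume) 0 := by
    have hVs := hasDerivAt_iff_tendsto_slope.1 (hV.generator φ)
    rw [hasDerivAt_iff_tendsto_slope, tendsto_iff_norm_sub_tendsto_zero]
    set η : L2 := I • (A φ).toLp 2 volume
    have hcont : Tendsto (fun t => ‖U (-t) η - η‖) (𝓝[≠] 0) (𝓝 0) := by
      have : Continuous fun t => ‖U (-t) η - η‖ :=
        (((hU.continuous η).comp continuous_neg).sub continuous_const).norm
      refine (this.tendsto' 0 0 ?_).mono_left nhdsWithin_le_nhds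
      simp [hU.map_zero]
    have hsum := (tendsto_iff_norm_sub_tendsto_zero.1 hVs).add hcont
    rw [add_zero] at hsum
    refine squeeze_zero (fun _ => norm_nonneg _) (fun t => ?_) hsum
    have : slope (fun t => U (-t) (V t χ - χ)) 0 t - η =
        U (-t) (slope (fun t => V t χ) 0 t - η) + (U (-t) η - η) := by
      simp [slope, hU.map_zero, hV.map_zero, map_sub]
    rw [this]
    refine (norm_add_le _ _).trans ?_
    rw [hU.norm_apply]
  have := hrest.fun_add hUneg
  simpa [map_sub] using this

/-- Two unitary groups with the same generator on Schwartz functions agree, if one of them leaves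
the Schwartz functions invariant. -/
theorem eq_of_invariant (hU : IsUnitaryGroupGeneratedBy A U)
    (hV : IsUnitaryGroupGeneratedBy A V)
    (hinv : ∀ t (φ : 𝓢(ℝ, ℂ)), ∃ χ : 𝓢(ℝ, ℂ), V t (φ.toLp 2 volume) = χ.toLp 2 volume) :
    U = V := by
  have hderiv (φ : 𝓢(ℝ, ℂ)) (t : ℝ) :
      HasDerivAt (fun t => U (-t) (V t (φ.toLp 2 volume))) 0 t := by
    obtain ⟨χ, hχ⟩ := hinv t φ
    have h0 := hU.hasDerivAt_neg_comp_zero hV χ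
    -- The group law moves the derivative at `t` to time 0, with the Schwartz vector `V(t)φ` as new
    -- initial state.
    have h2 : HasDerivAt (fun s => U (-t) (U (-(s - t)) (V (s - t) (χ.toLp 2 volume)))) 0 t := by
      have h3 : HasDerivAt (fun s : ℝ => s - t) 1 t := (hasDerivAt_id' t).sub_const t
      have h4 := h0.scomp_of_eq t h3 (sub_self t).symm
      simpa [Function.comp_def] using ((U (-t)).restrictScalars ℝ).hasFDerivAt.comp_hasDerivAt t h4
    convert h2 using 1
    ext1 s
    have e1 : U (-s) = U (-t) * U (-(s - t)) := by rw [← hU.map_add]; congr 1; ring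
    have e2 : V s = V (s - t) * V t := by rw [← hV.map_add]; congr 1; ring
    rw [e1, e2, ← hχ]
    rfl
  funext t
  refine DFunLike.coe_injective (dense_toLp.equalizer (U t).continuous (V t).continuous ?_)
  funext φ
  have hc := is_const_of_deriv_eq_zero (fun t => (hderiv φ t).differentiableAt)
    (fun t => (hderiv φ t).deriv) t 0
  simp only [hV.map_zero, hU.map_zero, neg_zero, one_apply_eq_self] at hc
  dsimp only [Function.comp_apply]
  rw [← hc, hU.neg_apply_apply, hc]

end IsUnitaryGroupGeneratedBy

theorem eq_weylGroup {ℏ α β : ℝ} {U : ℝ → L2 →L[ℂ] L2}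
    (hU : IsUnitaryGroupGeneratedBy (linComb ℏ α β) U) : U = weylGroup ℏ α β :=
  hU.eq_of_invariant (isUnitaryGroupGeneratedBy_weylGroup ℏ α β)
    fun t φ => ⟨_, weylOp_toLp (t * α) (t * (β * ℏ)) φ⟩

theorem expI_linComb_apply (ℏ α β : ℝ) (φ : L2) :
    expI (linComb ℏ α β) φ = weylOp α (β * ℏ) φ := by
  have h : ∃ U : ℝ → L2 →L[ℂ] L2, IsUnitaryGroupGeneratedBy (linComb ℏ α β) U :=
    ⟨_, isUnitaryGroupGeneratedBy_weylGroup ℏ α β⟩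
  rw [expI, dif_pos h, eq_weylGroup h.choose_spec, weylGroup_apply, one_mul, one_mul]

/-! ### The Fourier transform on the phase plane -/

theorem norm_exp_neg_I_mul_ofReal_eq_one (r : ℝ) : ‖Complex.exp (-I * (r : ℂ))‖ = 1 := by
  rw [neg_mul, mul_comm, ← neg_mul, ← ofReal_neg, Complex.norm_exp_ofReal_mul_I]

theorem norm_exp_I_mul_ofReal_eq_one (r : ℝ) : ‖Complex.exp (I * (r : ℂ))‖ = 1 := by
  rw [mul_comm, Complex.norm_exp_ofReal_mul_I]

/-- The plane is replaced by `ℂ`, which carries the Euclidean inner product; continuity and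
integrability of `ĝ` then follow from its being a rescaled Schwartz function. -/
theorem fourierPhase_eq_fourier (g : 𝓢(ℝ × ℝ, ℂ)) (w : ℝ × ℝ) :
    fourierPhase g w.1 w.2 = (1 / (2 * Real.pi) : ℂ) *
      (𝓕 (SchwartzMap.compCLMOfContinuousLinearEquiv ℂ equivRealProdCLM g) : 𝓢(ℂ, ℂ))
        ((2 * Real.pi)⁻¹ • measurableEquivRealProd.symm w) := by
  rw [fourierPhase, SchwartzMap.fourier_coe, Real.fourier_eq',
    ← volume_preserving_equiv_real_prod.integral_comp']
  congr 2
  funext v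
  rw [smul_eq_mul, mul_comm]
  congr 2
  rw [mul_comm, ← mul_neg_one I, mul_left_comm, mul_comm I]
  congr 1
  rw [← ofReal_one, ← ofReal_neg, ← ofReal_mul, Complex.inner]
  congr 1
  have h : (2 * Real.pi)⁻¹ * (2 * Real.pi) = 1 := inv_mul_cancel₀ Real.two_pi_pos.ne'
  simp [measurableEquivRealProd]
  linear_combination (w.1 * v.re + w.2 * v.im) * h

theorem continuous_fourierPhase (g : 𝓢(ℝ × ℝ, ℂ)) :
    Continuous fun w : ℝ × ℝ => fourierPhase g w.1 w.2 := by
  simp_rw [fourierPhase_eq_fourier]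
  have h : Continuous fun w : ℝ × ℝ => measurableEquivRealProd.symm w :=
    equivRealProdCLM.symm.continuous
  have h' : Continuous fun w : ℝ × ℝ => (2 * Real.pi)⁻¹ • measurableEquivRealProd.symm w := by
    fun_prop
  exact continuous_const.mul ((SchwartzMap.continuous _).comp h')

theorem integrable_fourierPhase (g : 𝓢(ℝ × ℝ, ℂ)) :
    Integrable fun w : ℝ × ℝ => fourierPhase g w.1 w.2 := by
  simp_rw [fourierPhase_eq_fourier]
  refine Integrable.const_mul ?_ _
  have h := ((𝓕 (SchwartzMap.compCLMOfContinuousLinearEquiv ℂ equivRealProdCLM g) :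
    𝓢(ℂ, ℂ)).integrable (μ := volume)).comp_smul (inv_ne_zero Real.two_pi_pos.ne')
  exact volume_preserving_equiv_real_prod.symm.integrable_comp_of_integrable h

theorem integrable_weylIntegrand (ℏ : ℝ) (g : 𝓢(ℝ × ℝ, ℂ)) (φ : L2) :
    Integrable (weylIntegrand ℏ g φ) := by
  have hcont : Continuous (weylIntegrand ℏ g φ) := by
    unfold weylIntegrand
    simp_rw [expI_linComb_apply]
    exact (continuous_fourierPhase g).smul
      ((continuous_weylOp φ).comp (f := fun w : ℝ × ℝ => (w.1, w.2 * ℏ)) (by fun_prop))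
  refine ((integrable_fourierPhase g).norm.mul_const ‖φ‖).mono' hcont.aestronglyMeasurable ?_
  filter_upwards with w
  rw [weylIntegrand, norm_smul, expI_linComb_apply, (weylOp _ _).norm_map]

/-- The Fourier transform in the momentum variable alone. -/
def partialFourier (g : ℝ × ℝ → ℂ) (β y : ℝ) : ℂ :=
  ∫ p : ℝ, g (y, p) * Complex.exp (-I * ((β * p : ℝ) : ℂ))

theorem integrable_mul_exp (g : 𝓢(ℝ × ℝ, ℂ)) (β : ℝ) :
    Integrable fun z : ℝ × ℝ => g z * Complex.exp (-I * ((β * z.2 : ℝ) : ℂ)) :=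
  g.integrable.mul_bdd (c := 1) (by fun_prop)
    (.of_forall fun z => (norm_exp_neg_I_mul_ofReal_eq_one _).le)

theorem integrable_partialFourier (g : 𝓢(ℝ × ℝ, ℂ)) (β : ℝ) :
    Integrable (partialFourier g β) :=
  (integrable_mul_exp g β).integral_prod_left

theorem continuous_partialFourier (g : 𝓢(ℝ × ℝ, ℂ)) (β : ℝ) :
    Continuous (partialFourier g β) := by
  obtain ⟨C₀, h₀, hC₀⟩ := g.decay 0 0
  obtain ⟨C₂, h₂, hC₂⟩ := g.decay 2 0
  simp only [norm_iteratedFDeriv_zero, pow_zero, one_mul] at hC₀ hC₂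
  have hg := g.continuous
  refine continuous_of_dominated (bound := fun p => (C₀ + C₂) * (1 + p ^ 2)⁻¹)
    (fun y => Continuous.aestronglyMeasurable (by fun_prop)) (fun y => .of_forall fun p => ?_)
    (integrable_inv_one_add_sq.const_mul _) (.of_forall fun p => by fun_prop)
  rw [norm_mul, norm_exp_neg_I_mul_ofReal_eq_one, mul_one, ← div_eq_mul_inv,
    le_div_iff₀ (by positivity)]
  have hp : p ^ 2 ≤ ‖(y, p)‖ ^ 2 := by
    rw [← sq_abs, ← Real.norm_eq_abs]
    exact pow_le_pow_left₀ (norm_nonneg _) (norm_snd_le (y, p)) 2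
  nlinarith [hC₀ (y, p), hC₂ (y, p), norm_nonneg (g (y, p))]

theorem fourier_partialFourier (g : 𝓢(ℝ × ℝ, ℂ)) (β ξ : ℝ) :
    𝓕 (partialFourier g β) ξ = 2 * Real.pi * fourierPhase g (2 * Real.pi * ξ) β := by
  have hint : Integrable fun z : ℝ × ℝ =>
      g z * Complex.exp (-I * ((2 * Real.pi * ξ * z.1 + β * z.2 : ℝ) : ℂ)) :=
    g.integrable.mul_bdd (c := 1) (by fun_prop)
      (.of_forall fun z => (norm_exp_neg_I_mul_ofReal_eq_one _).le)
  have hpi : (2 * Real.pi : ℂ) ≠ 0 := by exact_mod_cast Real.two_pi_pos.ne'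
  rw [fourierPhase, ← mul_assoc, mul_one_div_cancel hpi, one_mul, Measure.volume_eq_prod,
    integral_prod _ hint, Real.fourier_eq']
  congr 1
  funext x
  rw [partialFourier, smul_eq_mul, ← integral_const_mul]
  congr 1
  funext p
  rw [mul_left_comm, ← Complex.exp_add]
  congr 2
  simp
  ring

/-- Fourier inversion in position. Fubini supplies `h` for almost every `β`, which suffices under `∫
dβ`. -/
theorem integral_fourierPhase_mul_exp (g : 𝓢(ℝ × ℝ, ℂ)) {β : ℝ} (y : ℝ)
    (h : Integrable fun α => fourierPhase g α β) :
    ∫ α : ℝ, fourierPhase g α β * Complex.exp (I * ((α * y : ℝ) : ℂ)) =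
      partialFourier g β y := by
  have hF : 𝓕 (partialFourier g β) =
      fun ξ => 2 * Real.pi * fourierPhase g (2 * Real.pi * ξ) β :=
    funext (fourier_partialFourier g β)
  have hint : Integrable (𝓕 (partialFourier g β)) := by
    rw [hF]
    exact (h.comp_mul_left' Real.two_pi_pos.ne').const_mul _
  have hinv := congrFun ((continuous_partialFourier g β).fourierInv_fourier_eq
    (integrable_partialFourier g β) hint) y
  rw [← hinv, Real.fourierInv_eq', hF]
  have hsub := Measure.integral_comp_mul_left
    (fun α => fourierPhase g α β * Complex.exp (I * ((α * y : ℝ) : ℂ))) (2 * Real.pi)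
  have hpi : (2 * Real.pi : ℂ) ≠ 0 := by exact_mod_cast Real.two_pi_pos.ne'
  rw [abs_of_pos (by positivity), real_smul, ofReal_inv, ofReal_mul, ofReal_ofNat,
    eq_inv_mul_iff_mul_eq₀ hpi, ← integral_const_mul] at hsub
  rw [← hsub]
  congr 1
  funext ξ
  have harg : I * ((2 * Real.pi * ξ * y : ℝ) : ℂ) =
      ((2 * Real.pi * inner ℝ ξ y : ℝ) : ℂ) * I := by
    simp
    ring
  rw [harg]
  simp only [smul_eq_mul]
  ring

/-! ### Wigner's function -/

/-- The density matrix `ψ*(x + βħ/2) ψ(x - βħ/2)` in Weyl coordinates. -/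
def wignerKernel (ℏ : ℝ) (ψ : L2) (x β : ℝ) : ℂ :=
  conj (ψ (x + β * ℏ / 2)) * ψ (x - β * ℏ / 2)

theorem wignerIntegrand_eq (ℏ : ℝ) (ψ : L2) (z : ℝ × ℝ) (β : ℝ) :
    wignerIntegrand ℏ ψ z β =
      wignerKernel ℏ ψ z.1 β * Complex.exp (I * ((β * z.2 : ℝ) : ℂ)) := rfl

theorem stronglyMeasurable_wignerKernel (ℏ : ℝ) (ψ : L2) :
    StronglyMeasurable fun z : ℝ × ℝ => wignerKernel ℏ ψ z.1 z.2 := by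
  have h := (Lp.stronglyMeasurable ψ).measurable
  refine Measurable.stronglyMeasurable ?_
  unfold wignerKernel
  fun_prop

theorem integrable_norm_sq (ψ : L2) : Integrable fun x => ‖ψ x‖ ^ 2 :=
  (memLp_two_iff_integrable_sq_norm (Lp.aestronglyMeasurable ψ)).1 (Lp.memLp ψ)

theorem integral_norm_sq (ψ : L2) : ∫ x, ‖ψ x‖ ^ 2 = ‖ψ‖ ^ 2 := by
  rw [← inner_self_eq_norm_sq (𝕜 := ℂ), L2.inner_def, ← integral_re (L2.integrable_inner _ _)]
  simp_rw [inner_self_eq_norm_sq]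

theorem integrable_norm_sq_affine (ψ : L2) (x : ℝ) {c : ℝ} (hc : c ≠ 0) :
    Integrable fun β : ℝ => ‖ψ (x + β * c)‖ ^ 2 :=
  ((integrable_norm_sq ψ).comp_add_left x).comp_mul_right' hc

theorem integral_norm_sq_affine (ψ : L2) (x c : ℝ) :
    ∫ β : ℝ, ‖ψ (x + β * c)‖ ^ 2 = |c⁻¹| * ‖ψ‖ ^ 2 := by
  rw [Measure.integral_comp_mul_right (fun y => ‖ψ (x + y)‖ ^ 2),
    integral_add_left_eq_self (fun y => ‖ψ y‖ ^ 2), integral_norm_sq, smul_eq_mul]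

/-- AM-GM. Both squares are integrable in `β` with integrals independent of `x`, giving convergence
at every point and a bounded Wigner function. -/
theorem norm_wignerKernel_le (ℏ : ℝ) (ψ : L2) (x β : ℝ) : ‖wignerKernel ℏ ψ x β‖ ≤
    (‖ψ (x + β * (ℏ / 2))‖ ^ 2 + ‖ψ (x + β * -(ℏ / 2))‖ ^ 2) / 2 := by
  have h1 : x + β * ℏ / 2 = x + β * (ℏ / 2) := by ring
  have h2 : x - β * ℏ / 2 = x + β * -(ℏ / 2) := by ring
  rw [wignerKernel, h1, h2, norm_mul, RCLike.norm_conj]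
  nlinarith [sq_nonneg (‖ψ (x + β * (ℏ / 2))‖ - ‖ψ (x + β * -(ℏ / 2))‖)]

variable {ℏ : ℝ}

theorem integrable_wignerKernel (hℏ : 0 < ℏ) (ψ : L2) (x : ℝ) :
    Integrable (wignerKernel ℏ ψ x) := by
  have hc : ℏ / 2 ≠ 0 := by positivity
  refine (((integrable_norm_sq_affine ψ x hc).add
    (integrable_norm_sq_affine ψ x (neg_ne_zero.2 hc))).div_const 2).mono'
    ((stronglyMeasurable_wignerKernel ℏ ψ).comp_measurable
      measurable_prodMk_left).aestronglyMeasurable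
    (.of_forall fun β => norm_wignerKernel_le ℏ ψ x β)

theorem integral_norm_wignerKernel_le (hℏ : 0 < ℏ) (ψ : L2) (x : ℝ) :
    ∫ β, ‖wignerKernel ℏ ψ x β‖ ≤ 2 / ℏ * ‖ψ‖ ^ 2 := by
  have hc : ℏ / 2 ≠ 0 := by positivity
  have h1 := integrable_norm_sq_affine ψ x hc
  have h2 := integrable_norm_sq_affine ψ x (neg_ne_zero.2 hc)
  calc ∫ β, ‖wignerKernel ℏ ψ x β‖
      ≤ ∫ β, (‖ψ (x + β * (ℏ / 2))‖ ^ 2 + ‖ψ (x + β * -(ℏ / 2))‖ ^ 2) / 2 :=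
        integral_mono (integrable_wignerKernel hℏ ψ x).norm ((h1.add h2).div_const 2)
          fun β => norm_wignerKernel_le ℏ ψ x β
    _ = 2 / ℏ * ‖ψ‖ ^ 2 := by
        rw [integral_div, integral_add h1 h2, integral_norm_sq_affine, integral_norm_sq_affine,
          inv_neg, abs_neg, abs_of_pos (by positivity)]
        ring

theorem integrable_wignerIntegrand (hℏ : 0 < ℏ) (ψ : L2) (z : ℝ × ℝ) :
    Integrable (wignerIntegrand ℏ ψ z) :=
  (integrable_wignerKernel hℏ ψ z.1).mul_bdd (c := 1)
    (Continuous.aestronglyMeasurable (by fun_prop))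
    (.of_forall fun β => (norm_exp_I_mul_ofReal_eq_one _).le)

/-- The reflection `β ↦ -β` conjugates the integrand. -/
theorem wigner_im (ψ : L2) (z : ℝ × ℝ) : (wigner ℏ ψ z).im = 0 := by
  rw [← Complex.conj_eq_iff_im, wigner, map_mul, ← integral_conj,
    ← integral_neg_eq_self (wignerIntegrand ℏ ψ z)]
  congr 1
  · rw [map_div₀, map_mul, conj_ofReal, map_one, map_ofNat]
  · congr 1
    funext β
    have h1 : z.1 + -β * ℏ / 2 = z.1 - β * ℏ / 2 := by ring
    have h2 : z.1 - -β * ℏ / 2 = z.1 + β * ℏ / 2 := by ring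
    simp only [wignerIntegrand, h1, h2, map_mul, Complex.conj_conj, ← Complex.exp_conj, conj_I,
      conj_ofReal]
    rw [mul_comm (ψ _)]
    congr 2
    push_cast
    ring

theorem stronglyMeasurable_wigner (ψ : L2) : StronglyMeasurable (wigner ℏ ψ) := by
  have h : StronglyMeasurable fun w : (ℝ × ℝ) × ℝ => wignerIntegrand ℏ ψ w.1 w.2 := by
    refine StronglyMeasurable.mul ((stronglyMeasurable_wignerKernel ℏ ψ).comp_measurable
      (g := fun w : (ℝ × ℝ) × ℝ => (w.1.1, w.2)) (by fun_prop))
      (Continuous.stronglyMeasurable (by fun_prop))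
  exact h.integral_prod_right.const_mul _

theorem norm_wigner_le (hℏ : 0 < ℏ) (ψ : L2) (z : ℝ × ℝ) :
    ‖wigner ℏ ψ z‖ ≤ ‖(1 / (2 * Real.pi) : ℂ)‖ * (2 / ℏ * ‖ψ‖ ^ 2) := by
  rw [wigner, norm_mul]
  refine mul_le_mul_of_nonneg_left (le_trans ?_ (integral_norm_wignerKernel_le hℏ ψ z.1))
    (norm_nonneg _)
  refine (norm_integral_le_integral_norm _).trans_eq ?_
  simp_rw [wignerIntegrand_eq, norm_mul, norm_exp_I_mul_ofReal_eq_one, mul_one]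

theorem integrable_mul_wigner (hℏ : 0 < ℏ) (ψ : L2) (g : 𝓢(ℝ × ℝ, ℂ)) :
    Integrable fun z => g z * wigner ℏ ψ z :=
  g.integrable.mul_bdd (stronglyMeasurable_wigner ψ).aestronglyMeasurable
    (.of_forall (norm_wigner_le hℏ ψ))

/-! ### Weyl compatibility -/

theorem wigner_eq_integral_neg (ψ : L2) (z : ℝ × ℝ) :
    wigner ℏ ψ z = (1 / (2 * Real.pi) : ℂ) *
      ∫ β, wignerKernel ℏ ψ z.1 (-β) * Complex.exp (-I * ((β * z.2 : ℝ) : ℂ)) := by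
  rw [wigner, ← integral_neg_eq_self (wignerIntegrand ℏ ψ z)]
  simp [wignerIntegrand_eq]

/-- Licenses Fubini in `(x, p, β)`: `g` is integrable and the kernel's `L¹` norm in `β` is bounded
uniformly in `x`. -/
theorem integrable_phaseSpace (hℏ : 0 < ℏ) (ψ : L2) (g : 𝓢(ℝ × ℝ, ℂ)) :
    Integrable (fun w : (ℝ × ℝ) × ℝ => g w.1 *
      (wignerKernel ℏ ψ w.1.1 (-w.2) * Complex.exp (-I * ((w.2 * w.1.2 : ℝ) : ℂ)))) := by
  have hg := g.continuous
  have hmeas : StronglyMeasurable (fun w : (ℝ × ℝ) × ℝ => g w.1 *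
      (wignerKernel ℏ ψ w.1.1 (-w.2) * Complex.exp (-I * ((w.2 * w.1.2 : ℝ) : ℂ)))) :=
    (Continuous.stronglyMeasurable (by fun_prop)).mul
      (((stronglyMeasurable_wignerKernel ℏ ψ).comp_measurable
        (g := fun w : (ℝ × ℝ) × ℝ => (w.1.1, -w.2)) (by fun_prop)).mul
        (Continuous.stronglyMeasurable (by fun_prop)))
  rw [Measure.volume_eq_prod, integrable_prod_iff hmeas.aestronglyMeasurable]
  have hk (z : ℝ × ℝ) : Integrable fun β => wignerKernel ℏ ψ z.1 (-β) :=
    (integrable_wignerKernel hℏ ψ z.1).comp_neg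
  refine ⟨.of_forall fun z => ?_, ?_⟩
  · exact ((hk z).mul_bdd (c := 1) (Continuous.aestronglyMeasurable (by fun_prop))
      (.of_forall fun β => (norm_exp_neg_I_mul_ofReal_eq_one _).le)).const_mul (g z)
  · refine (g.integrable.norm.mul_const (2 / ℏ * ‖ψ‖ ^ 2)).mono'
      hmeas.norm.integral_prod_right.aestronglyMeasurable (.of_forall fun z => ?_)
    rw [Real.norm_of_nonneg (integral_nonneg fun _ => norm_nonneg _)]
    simp_rw [norm_mul, norm_exp_neg_I_mul_ofReal_eq_one, mul_one]
    rw [integral_const_mul, integral_neg_eq_self (fun β => ‖wignerKernel ℏ ψ z.1 β‖)]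
    exact mul_le_mul_of_nonneg_left (integral_norm_wignerKernel_le hℏ ψ z.1) (norm_nonneg _)

theorem integral_mul_wigner (hℏ : 0 < ℏ) (ψ : L2) (g : 𝓢(ℝ × ℝ, ℂ)) :
    ∫ z, g z * wigner ℏ ψ z = (1 / (2 * Real.pi) : ℂ) *
      ∫ β : ℝ, ∫ y : ℝ, wignerKernel ℏ ψ y (-β) * partialFourier g β y := by
  have hint := integrable_phaseSpace hℏ ψ g
  simp_rw [wigner_eq_integral_neg, mul_left_comm (g _), integral_const_mul,
    ← integral_const_mul (g _)]
  congr 1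
  rw [integral_integral_swap hint]
  refine integral_congr_ae ?_
  filter_upwards [hint.prod_left_ae] with β hβ
  rw [Measure.volume_eq_prod, integral_prod _ hβ]
  congr 1
  funext y
  rw [partialFourier, ← integral_const_mul]
  congr 1
  funext p
  ring

theorem integrable_wignerKernel_left (ψ : L2) (β : ℝ) :
    Integrable fun y => wignerKernel ℏ ψ y β := by
  have h1 : MemLp (fun y => ψ (y + β * ℏ / 2)) 2 volume :=
    (Lp.memLp ψ).comp_measurePreserving (measurePreserving_add_right volume _)
  have h2 : MemLp (fun y => ψ (y - β * ℏ / 2)) 2 volume :=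
    (Lp.memLp ψ).comp_measurePreserving (measurePreserving_sub_right volume _)
  exact h1.star.integrable_mul h2

theorem inner_weylOp (ψ : L2) (α β : ℝ) :
    inner ℂ ψ (weylOp α (β * ℏ) ψ) =
      ∫ y : ℝ, wignerKernel ℏ ψ y (-β) * Complex.exp (I * ((α * y : ℝ) : ℂ)) := by
  rw [L2.inner_def]
  have h : ∀ᵐ x, inner ℂ (ψ x) (weylOp α (β * ℏ) ψ x) =
      conj (ψ x) * (planeWave α (α * (β * ℏ) / 2) x * ψ (x + β * ℏ)) := by
    filter_upwards [weylOp_ae α (β * ℏ) ψ] with x hx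
    rw [hx, RCLike.inner_apply, mul_comm]
  -- Shifting by half the translation makes the arguments of `ψ` symmetric about `y` and absorbs the
  -- phase `αβħ/2`.
  rw [integral_congr_ae h, ← integral_sub_right_eq_self _ (β * ℏ / 2)]
  congr 1
  funext y
  have h1 : y + -β * ℏ / 2 = y - β * ℏ / 2 := by ring
  have h2 : y - -β * ℏ / 2 = y - β * ℏ / 2 + β * ℏ := by ring
  have h3 : α * (y - β * ℏ / 2) + α * (β * ℏ) / 2 = α * y := by ring
  rw [wignerKernel, planeWave, h1, h2, h3]
  ring

theorem inner_weylQuantization (ψ : L2) (g : 𝓢(ℝ × ℝ, ℂ)) :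
    inner ℂ ψ (weylQuantization ℏ g ψ) = (1 / (2 * Real.pi) : ℂ) *
      ∫ β : ℝ, ∫ y : ℝ, wignerKernel ℏ ψ y (-β) * partialFourier g β y := by
  have hint := integrable_weylIntegrand ℏ g ψ
  rw [weylQuantization, inner_smul_right, ← integral_inner hint, Measure.volume_eq_prod,
    integral_prod_symm _ (hint.const_inner ψ)]
  congr 1
  refine integral_congr_ae ?_
  filter_upwards [(integrable_fourierPhase g).prod_left_ae] with β hβ
  have hswap : Integrable (Function.uncurry fun α y : ℝ => fourierPhase g α β *
      (wignerKernel ℏ ψ y (-β) * Complex.exp (I * ((α * y : ℝ) : ℂ)))) := by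
    have := (hβ.mul_prod (integrable_wignerKernel_left (ℏ := ℏ) ψ (-β))).mul_bdd (c := 1)
      (g := fun z : ℝ × ℝ => Complex.exp (I * ((z.1 * z.2 : ℝ) : ℂ)))
      (Continuous.aestronglyMeasurable (by fun_prop))
      (.of_forall fun z => (norm_exp_I_mul_ofReal_eq_one _).le)
    refine this.congr (.of_forall fun z => ?_)
    simp [Function.uncurry, mul_assoc]
  simp only [weylIntegrand, inner_smul_right, expI_linComb_apply, inner_weylOp,
    ← integral_const_mul]
  rw [integral_integral_swap hswap]
  congr 1
  funext y
  simp_rw [mul_left_comm (fourierPhase _ _ _), integral_const_mul]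
  rw [integral_fourierPhase_mul_exp g y hβ]

theorem isWeylCompatible_wigner (hℏ : 0 < ℏ) (ψ : L2) :
    IsWeylCompatible ℏ ψ (wigner ℏ ψ) := fun g =>
  ⟨integrable_mul_wigner hℏ ψ g, by rw [integral_mul_wigner hℏ, inner_weylQuantization]⟩

/-- Testing against a bump equal to 1 near `z` shows that `f` is integrable there. Its measurability
is not assumed but comes from the integrability of `g f`. -/
theorem IsWeylCompatible.locallyIntegrable {ψ : L2} {f : ℝ × ℝ → ℂ}
    (hf : IsWeylCompatible ℏ ψ f) : LocallyIntegrable f := by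
  intro z
  let b : ContDiffBump z := ⟨1, 2, one_pos, one_lt_two⟩
  have hsupp : HasCompactSupport fun x => ((b x : ℝ) : ℂ) :=
    b.hasCompactSupport.comp_left (g := fun r : ℝ => (r : ℂ)) ofReal_zero
  have hdiff : ContDiff ℝ (⊤ : ℕ∞) fun x => ((b x : ℝ) : ℂ) :=
    Complex.ofRealCLM.contDiff.comp b.contDiff
  refine ⟨Metric.closedBall z 1, Metric.closedBall_mem_nhds z one_pos, ?_⟩
  refine ((hf (hsupp.toSchwartzMap hdiff)).1.integrableOn (s := Metric.closedBall z 1)).congr_fun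
    (fun x hx => ?_) Metric.isClosed_closedBall.measurableSet
  change ((b x : ℝ) : ℂ) * f x = f x
  rw [b.one_of_mem_closedBall hx, ofReal_one, one_mul]

theorem IsWeylCompatible.ae_eq {ψ : L2} {f f' : ℝ × ℝ → ℂ} (hf : IsWeylCompatible ℏ ψ f)
    (hf' : IsWeylCompatible ℏ ψ f') : f =ᵐ[volume] f' := by
  refine ae_eq_of_integral_contDiff_smul_eq hf.locallyIntegrable hf'.locallyIntegrable
    fun g hg hsupp => ?_
  have hsupp' : HasCompactSupport fun x => ((g x : ℝ) : ℂ) :=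
    hsupp.comp_left (g := fun r : ℝ => (r : ℂ)) ofReal_zero
  have hdiff : ContDiff ℝ (⊤ : ℕ∞) fun x => ((g x : ℝ) : ℂ) :=
    Complex.ofRealCLM.contDiff.comp hg
  simp_rw [real_smul]
  exact (hf (hsupp'.toSchwartzMap hdiff)).2.trans (hf' (hsupp'.toSchwartzMap hdiff)).2.symm

end WeylWigner

end

theorem mainTheorem2 (ℏ : ℝ) (hℏ : 0 < ℏ) (ψ : WeylWigner.L2) (hψ : ‖ψ‖ = 1) :
    -- the unitary groups `t ↦ e^{it(αX+βP)}` are well defined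
    (∀ α β : ℝ, ∃! U : ℝ → WeylWigner.L2 →L[ℂ] WeylWigner.L2,
      WeylWigner.IsUnitaryGroupGeneratedBy (WeylWigner.linComb ℏ α β) U) ∧
    -- the integral defining `g(X,P)` converges strongly
    (∀ (g : 𝓢(ℝ × ℝ, ℂ)) (φ : WeylWigner.L2),
      Integrable (WeylWigner.weylIntegrand ℏ g φ)) ∧
    -- the integral defining Wigner's function converges at every point, with a real value
    (∀ z : ℝ × ℝ, Integrable (WeylWigner.wignerIntegrand ℏ ψ z) ∧
      (WeylWigner.wigner ℏ ψ z).im = 0) ∧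
    -- Wigner's function is Weyl-compatible
    WeylWigner.IsWeylCompatible ℏ ψ (WeylWigner.wigner ℏ ψ) ∧
    -- and it is the only Weyl-compatible function, up to equality almost everywhere
    (∀ f : ℝ × ℝ → ℂ, WeylWigner.IsWeylCompatible ℏ ψ f →
      f =ᵐ[volume] WeylWigner.wigner ℏ ψ) :=
  ⟨fun α β => ⟨_, WeylWigner.isUnitaryGroupGeneratedBy_weylGroup ℏ α β,
      fun _ hU => WeylWigner.eq_weylGroup hU⟩,
    WeylWigner.integrable_weylIntegrand ℏ,
    fun z => ⟨WeylWigner.integrable_wignerIntegrand hℏ ψ z, WeylWigner.wigner_im ψ z⟩,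
    WeylWigner.isWeylCompatible_wigner hℏ ψ,
    fun _ hf => hf.ae_eq (WeylWigner.isWeylCompatible_wigner hℏ ψ)⟩
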